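/- Let $(W,S)$ be a Coxeter system with $S=\{s_1,\dots,s_k\}$ finite, whose Coxeter diagram (vertex set $S$; distinct $s_i,s_j$ are joined by an edge iff $m_{ij}<\infty$) is connected, and let $\rho:W\to\mathrm{Isom}(\mathbb H^n)$ be a discrete and faithful representation. Choose, for every pair $\{s_i,s_j\}$, $i\ne j$, that generates a finite (dihedral) subgroup, a point of $\mathbb H^n$ fixed by $\rho(s_i)$ and $\rho(s_j)$, and let $X$ be the (finite) set of chosen points. Let $(T,p)$ be a Gromov approximating tree for $X$: for some $c>0$ with $|X|\le 2^c+2$, $T$ is a finite metric tree and $p$ is a map from $X$ to the vertices of $T$ such that every leaf of $T$ lies in $p(X)$ and $$d_{\mathbb H}(x,y)-2c\ln 3\le d_T(p(x),p(y))\le d_{\mathbb H}(x,y)\qquad (x,y\in X).$$ For a vertex $v$ of $T$ let $\mathrm{Lab}(v)=\bigcup_{x\in p^{-1}(v)}\{s\in S:\rho(s)x=x\}$ (empty if $v\notin p(X)$), and let $\overline{\mathrm{Lab}}$ be its canonical extension: $s\in\overline{\mathrm{Lab}}(v)$ iff $v$ lies on the path $[ab]$ in $T$ for some vertices $a,b$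 with $s\in\mathrm{Lab}(a)\cap\mathrm{Lab}(b)$. Let $e$ be an oriented edge of $T$, and let $T^+(e)$, $T^-(e)$ be the components of $T$ minus the open edge $e$, with $e$ oriented toward $T^+(e)$. Call $e$ useless if $\bigcup_{v\in T^+(e)}\overline{\mathrm{Lab}}(v)=S$ or $\bigcup_{v\in T^-(e)}\overline{\mathrm{Lab}}(v)=S$. Let $L$ be either of the labellings $\mathrm{Lab}$, $\overline{\mathrm{Lab}}$, and put $$S^{\pm}(e)=\bigcup_{v\in T^{\pm}(e)}L(v),\qquad S^*(e)=S^+(e)\cap S^-(e).$$ Then $\langle S^+(e)\rangle *_{\langle S^*(e)\rangle}\langle S^-(e)\rangle$, with amalgamation maps induced by the inclusions $S^*(e)\hookrightarrow S^{\pm}(e)$, is a special splitting of $(W,S)$, i.e. the inclusions of the special subgroups $\langle S^{\pm}(e)\rangle$ in $W$ induce an isomorphism from this amalgamated product onto $W$. Furthermore, the splitting is trivial (that is, one of the two amalgamation maps $\langle S^*(e)\rangle\to\langle S^{\pm}(e)\rangle$ is an isomorphism) if and only if $e$ is useless, and $e$ is useless if and only if $S^+(e)=S$ or $S^-(e)=S$.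 -/

import Mathlib

noncomputable section

/-! ### Real hyperbolic space and its isometry group -/

/-- Real hyperbolic `n`-space, in the hyperboloid model: the points `(t, v)` of `ℝ × ℝⁿ` with
`t ^ 2 = 1 + ‖v‖ ^ 2` and `t > 0`. -/
@[ext]
structure HyperbolicSpace (n : ℕ) where
  time : ℝ
  space : EuclideanSpace ℝ (Fin n)
  time_sq : time ^ 2 = 1 + ‖space‖ ^ 2
  time_pos : 0 < time

namespace HyperbolicSpace

variable {n : ℕ}

/-- The negative of the Lorentzian product of two points of the hyperboloid. -/
def lorentz (x y : HyperbolicSpace n) : ℝ :=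
  x.time * y.time - inner ℝ x.space y.space

theorem lorentz_comm (x y : HyperbolicSpace n) : lorentz x y = lorentz y x := by
  simp only [lorentz, real_inner_comm, mul_comm]

theorem lorentz_self (x : HyperbolicSpace n) : lorentz x x = 1 := by
  have h := x.time_sq
  simp only [lorentz, real_inner_self_eq_norm_sq]
  nlinarith

theorem one_add_le_time_mul (x y : HyperbolicSpace n) :
    1 + ‖x.space‖ * ‖y.space‖ ≤ x.time * y.time := by
  have hx := x.time_sq
  have hy := y.time_sq
  have h : (1 + ‖x.space‖ * ‖y.space‖) ^ 2 ≤ (x.time * y.time) ^ 2 := by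
    rw [mul_pow, hx, hy]
    nlinarith [sq_nonneg (‖x.space‖ - ‖y.space‖)]
  exact le_of_sq_le_sq h (mul_pos x.time_pos y.time_pos).le

theorem one_le_lorentz (x y : HyperbolicSpace n) : 1 ≤ lorentz x y := by
  have h := one_add_le_time_mul x y
  have h' := real_inner_le_norm x.space y.space
  simp only [lorentz]
  linarith

theorem eq_of_lorentz_eq_one {x y : HyperbolicSpace n} (h : lorentz x y = 1) : x = y := by
  have hx := x.time_sq
  have hy := y.time_sq
  have h1 := one_add_le_time_mul x y
  have h2 := real_inner_le_norm x.space y.space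
  simp only [lorentz] at h
  have h3 : x.time * y.time = 1 + ‖x.space‖ * ‖y.space‖ := by linarith
  have h4 : (x.time * y.time) ^ 2 = (1 + ‖x.space‖ * ‖y.space‖) ^ 2 := by rw [h3]
  rw [mul_pow, hx, hy] at h4
  have h5 : ‖x.space‖ = ‖y.space‖ := by
    have : (‖x.space‖ - ‖y.space‖) ^ 2 = 0 := by nlinarith
    have := pow_eq_zero_iff (two_ne_zero) |>.1 this
    linarith
  have h6 : x.time = y.time := by
    have : x.time ^ 2 = y.time ^ 2 := by rw [hx, hy, h5]
    exact (pow_left_inj₀ x.time_pos.le y.time_pos.le two_ne_zero).1 this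
  have h7 : ‖x.space - y.space‖ ^ 2 = 0 := by
    rw [norm_sub_sq_real]
    rw [h6] at h hx
    nlinarith
  have h8 : x.space = y.space := by
    have := pow_eq_zero_iff (two_ne_zero) |>.1 h7
    exact sub_eq_zero.1 (norm_eq_zero.1 this)
  exact HyperbolicSpace.ext h6 h8

theorem sq_le_of_orthogonal (y : HyperbolicSpace n) (a : ℝ) (v : EuclideanSpace ℝ (Fin n))
    (h : a * y.time = inner ℝ v y.space) : a ^ 2 ≤ ‖v‖ ^ 2 := by
  have hy := y.time_sq
  have h1 := abs_real_inner_le_norm v y.space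
  have h2 : (a * y.time) ^ 2 ≤ (‖v‖ * ‖y.space‖) ^ 2 := by
    rw [h, ← sq_abs]
    exact pow_le_pow_left₀ (abs_nonneg _) h1 2
  rw [mul_pow, mul_pow, hy] at h2
  by_contra hlt
  push Not at hlt
  nlinarith [sq_nonneg ‖y.space‖, mul_nonneg (sub_nonneg.2 hlt.le) (sq_nonneg ‖y.space‖)]

theorem lorentz_le (x y z : HyperbolicSpace n) :
    lorentz x z ≤ lorentz x y * lorentz y z +
      √(lorentz x y ^ 2 - 1) * √(lorentz y z ^ 2 - 1) := by
  have hA := one_le_lorentz x y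
  have hB := one_le_lorentz y z
  have hx := x.time_sq
  have hy := y.time_sq
  have hz := z.time_sq
  have key : ∀ t : ℝ, 0 ≤ (lorentz y z ^ 2 - 1) * (t * t) +
      (2 * (lorentz x y * lorentz y z - lorentz x z)) * t + (lorentz x y ^ 2 - 1) := by
    intro t
    have h := sq_le_of_orthogonal y
      ((x.time - lorentz x y * y.time) + t * (z.time - lorentz y z * y.time))
      ((x.space - lorentz x y • y.space) + t • (z.space - lorentz y z • y.space))
      (by
        simp only [inner_add_left, inner_sub_left, real_inner_smul_left,
          real_inner_self_eq_norm_sq, real_inner_comm y.space z.space]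
        simp only [lorentz]
        have e : y.time * y.time = 1 + ‖y.space‖ ^ 2 := by rw [← hy]; ring
        linear_combination
          (-(x.time * y.time - inner ℝ x.space y.space)
            - t * (y.time * z.time - inner ℝ y.space z.space)) * e)
    rw [← real_inner_self_eq_norm_sq] at h
    simp only [inner_add_left, inner_sub_left, real_inner_smul_left,
      inner_add_right, inner_sub_right, real_inner_smul_right] at h
    have e1 : inner ℝ x.space y.space = x.time * y.time - lorentz x y := by simp [lorentz]
    have e2 : inner ℝ x.space z.space = x.time * z.time - lorentz x z := by simp [lorentz]
    have e3 : inner ℝ y.space z.space = y.time * z.time - lorentz y z := by simp [lorentz]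
    have f1 : inner ℝ y.space x.space = x.time * y.time - lorentz x y := by
      rw [real_inner_comm, e1]
    have f2 : inner ℝ z.space x.space = x.time * z.time - lorentz x z := by
      rw [real_inner_comm, e2]
    have f3 : inner ℝ z.space y.space = y.time * z.time - lorentz y z := by
      rw [real_inner_comm, e3]
    have g1 : inner ℝ x.space x.space = x.time ^ 2 - 1 := by
      rw [real_inner_self_eq_norm_sq]; linarith
    have g2 : inner ℝ y.space y.space = y.time ^ 2 - 1 := by
      rw [real_inner_self_eq_norm_sq]; linarith
    have g3 : inner ℝ z.space z.space = z.time ^ 2 - 1 := by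
      rw [real_inner_self_eq_norm_sq]; linarith
    simp only [e1, e2, e3, f1, f2, f3, g1, g2, g3] at h
    nlinarith
  have hd := discrim_le_zero key
  rw [discrim] at hd
  rw [← Real.sqrt_mul (by nlinarith)]
  have h1 : (lorentz x z - lorentz x y * lorentz y z) ^ 2 ≤
      (lorentz x y ^ 2 - 1) * (lorentz y z ^ 2 - 1) := by nlinarith
  have h2 := Real.le_sqrt_of_sq_le h1
  linarith

/-- The hyperbolic metric: `cosh (d(x, y))` is the negative of the Lorentzian product. -/
instance : MetricSpace (HyperbolicSpace n) where
  dist x y := Real.arcosh (lorentz x y)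
  dist_self x := by
    rw [lorentz_self, Real.arcosh_eq_zero_iff le_rfl]
  dist_comm x y := by
    rw [lorentz_comm]
  dist_triangle x y z := by
    have hA := one_le_lorentz x y
    have hB := one_le_lorentz y z
    have hC := one_le_lorentz x z
    rw [← Real.arcosh_cosh (add_nonneg (Real.arcosh_nonneg hA) (Real.arcosh_nonneg hB)),
      Real.arcosh_le_arcosh (by linarith) (Real.cosh_pos _), Real.cosh_add,
      Real.cosh_arcosh hA, Real.cosh_arcosh hB, Real.sinh_arcosh hA, Real.sinh_arcosh hB]
    exact lorentz_le x y z
  eq_of_dist_eq_zero {x y} h := by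
    change Real.arcosh (lorentz x y) = 0 at h
    exact eq_of_lorentz_eq_one ((Real.arcosh_eq_zero_iff (one_le_lorentz x y)).1 h)

/-- The isometry group of hyperbolic space. -/
abbrev Isom (n : ℕ) : Type := HyperbolicSpace n ≃ᵢ HyperbolicSpace n

/-- The compact-open topology on the isometry group. -/
instance : TopologicalSpace (Isom n) :=
  TopologicalSpace.induced
    (fun g : Isom n => (⟨g, g.continuous⟩ : C(HyperbolicSpace n, HyperbolicSpace n)))
    inferInstance

end HyperbolicSpace

/-- An isometric action of `W` on hyperbolic `n`-space is discrete and faithful if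
`ρ : W → Isom(ℍⁿ)` is injective with discrete image. -/
def IsDiscreteFaithful {W : Type*} [Group W] {n : ℕ} (ρ : W →* HyperbolicSpace.Isom n) : Prop :=
  DiscreteTopology ρ.range ∧ Function.Injective ρ

/-! ### Coxeter systems: diagram, special subgroups, special splittings -/

section Coxeter

variable {B : Type*} {M : CoxeterMatrix B} {W : Type*} [Group W]

/-- The Coxeter diagram: distinct generators `i`, `j` are joined when `m i j` is finite
(Mathlib encodes `m i j = ∞` as `M i j = 0`). -/
def coxeterDiagram (M : CoxeterMatrix B) : SimpleGraph B where
  Adj i j := i ≠ j ∧ M i j ≠ 0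
  symm := ⟨fun i j h => ⟨h.1.symm, by rw [M.symmetric]; exact h.2⟩⟩
  loopless := ⟨fun _ h => h.1 rfl⟩

/-- The special subgroup `⟨J⟩` generated by a set `J` of fundamental generators. -/
def specialSubgroup (cs : CoxeterSystem M W) (J : Set B) : Subgroup W :=
  Subgroup.closure (cs.simple '' J)

theorem specialSubgroup_mono (cs : CoxeterSystem M W) {J K : Set B} (h : J ⊆ K) :
    specialSubgroup cs J ≤ specialSubgroup cs K :=
  Subgroup.closure_mono (Set.image_mono h)

/-- The homomorphism `⟨J⟩ → ⟨K⟩` induced by an inclusion `J ⊆ K` of sets of generators. -/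
def specialInclusion (cs : CoxeterSystem M W) {J K : Set B} (h : J ⊆ K) :
    specialSubgroup cs J →* specialSubgroup cs K :=
  Subgroup.inclusion (specialSubgroup_mono cs h)

/-- The amalgamated product `⟨J true⟩ *_⟨C⟩ ⟨J false⟩`, whose amalgamation maps are induced by
the inclusions of `C` in `J true` and in `J false`. -/
abbrev SpecialAmalgam (cs : CoxeterSystem M W) {J : Bool → Set B} {C : Set B}
    (h : ∀ b, C ⊆ J b) : Type _ :=
  Monoid.PushoutI (fun b : Bool => specialInclusion cs (h b))

/-- The homomorphism from the amalgamated product to `W` which restricts to the inclusions of the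
special subgroups. -/
def SpecialAmalgam.toGroup (cs : CoxeterSystem M W) {J : Bool → Set B} {C : Set B}
    (h : ∀ b, C ⊆ J b) : SpecialAmalgam cs h →* W :=
  Monoid.PushoutI.lift (fun b => (specialSubgroup cs (J b)).subtype)
    (specialSubgroup cs C).subtype (fun _ => rfl)

/-- `⟨J true⟩ *_⟨C⟩ ⟨J false⟩` is a special splitting of `(W, S)`: the set `C` is contained in
`J true` and in `J false`, and the amalgamated product along the maps induced by these inclusions
is `W` (the inclusions of the special subgroups induce an isomorphism). -/
def IsSpecialSplitting (cs : CoxeterSystem M W) (J : Bool → Set B) (C : Set B) : Prop :=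
  ∃ h : ∀ b, C ⊆ J b, Function.Bijective (SpecialAmalgam.toGroup cs h)

/-- The splitting is trivial: one of the amalgamation maps is an isomorphism. -/
def IsTrivialSplitting (cs : CoxeterSystem M W) (J : Bool → Set B) (C : Set B) : Prop :=
  ∃ (b : Bool) (h : C ⊆ J b), Function.Bijective (specialInclusion cs h)

/-- The set of two-element sets of generators which generate a finite (dihedral) subgroup. -/
def finiteDihedralPairs (cs : CoxeterSystem M W) : Set (Finset B) :=
  {P | P.card = 2 ∧ Finite (specialSubgroup cs (P : Set B))}

/-- `X` is a set of representative points from the fixed-point sets of the pairs of generators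
which generate finite dihedral groups: one fixed point is chosen for every such pair, and `X` is
the set of the chosen points. -/
def IsRepresentativeSet (cs : CoxeterSystem M W) {n : ℕ} (ρ : W →* HyperbolicSpace.Isom n)
    (X : Set (HyperbolicSpace n)) : Prop :=
  ∃ r : finiteDihedralPairs cs → HyperbolicSpace n,
    (∀ P, ∀ i ∈ P.1, ρ (cs.simple i) (r P) = r P) ∧ X = Set.range r

end Coxeter

/-! ### Metric trees, approximating trees and labellings -/

/-- A finite metric tree with vertex set `V`: a tree with a positive length for every edge. -/
structure MetricTree (V : Type*) [Finite V] where
  graph : SimpleGraph V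
  isTree : graph.IsTree
  length : Sym2 V → ℝ
  length_pos : ∀ e ∈ graph.edgeSet, 0 < length e

namespace MetricTree

variable {V : Type*} [Finite V] (T : MetricTree V)

/-- The unique path in `T` from `a` to `b`. -/
def path (a b : V) : T.graph.Walk a b :=
  (T.isTree.existsUnique_path a b).choose

/-- The vertices of the path `[ab]`. -/
def segment (a b : V) : Set V :=
  {v | v ∈ (T.path a b).support}

/-- The distance in `T` of two vertices: the sum of the lengths of the edges of `[ab]`. -/
def treeDist (a b : V) : ℝ :=
  ((T.path a b).edges.map T.length).sum

/-- The leaves of `T` (the vertices of valence one). -/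
def leaves : Set V :=
  {v | (T.graph.neighborSet v).ncard = 1}

/-- For an oriented edge `e`, the vertices of `T⁺(e)` (`b = true`), the component of `T` minus the
open edge `e` toward which `e` is oriented, and of the other component `T⁻(e)` (`b = false`). -/
def side (e : T.graph.Dart) (b : Bool) : Set V :=
  {v | (T.graph.deleteEdges {e.edge}).Reachable (if b then e.snd else e.fst) v}

/-- The canonical extension of a labelling `L`: the label `s` is put on every vertex of every path
`[ab]` whose ends both have the label `s` for `L`. -/
def canonicalExtension {B : Type*} (L : V → Set B) (v : V) : Set B :=
  {s | ∃ a b, v ∈ T.segment a b ∧ s ∈ L a ∩ L b}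

/-- The labels on `T⁺(e)` (`b = true`) or on `T⁻(e)` (`b = false`). -/
def labelsOnSide {B : Type*} (L : V → Set B) (e : T.graph.Dart) (b : Bool) : Set B :=
  ⋃ v ∈ T.side e b, L v

/-- The edge `e` is useless for the labelling `L`: one of the two components of its complement
carries all the labels. -/
def IsUseless {B : Type*} (L : V → Set B) (e : T.graph.Dart) : Prop :=
  ∃ b, Set.univ ⊆ T.labelsOnSide L e b

/-- `(T, p)` is a Gromov approximating tree, with parameter `c > 0`, for the finite set
`X ⊆ ℍⁿ`; here `ln 3` is the hyperbolicity constant of `ℍⁿ`. -/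
structure IsGromovApproximating {n : ℕ} (X : Set (HyperbolicSpace n)) (p : X → V) (c : ℝ) :
    Prop where
  finite : X.Finite
  c_pos : 0 < c
  card_le : (X.ncard : ℝ) ≤ 2 ^ c + 2
  leaves_subset : T.leaves ⊆ Set.range p
  le_treeDist : ∀ x y : X,
    dist (x : HyperbolicSpace n) y - 2 * c * Real.log 3 ≤ T.treeDist (p x) (p y)
  treeDist_le : ∀ x y : X, T.treeDist (p x) (p y) ≤ dist (x : HyperbolicSpace n) y

end MetricTree

/-- The labelling of the vertices of the tree by fundamental generators: `v` is labelled by the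
generators which fix some point `x` of `X` with `p x = v` (so `v` has no label if it is not in
`p(X)`). -/
def fixLabelling {B : Type*} {M : CoxeterMatrix B} {W : Type*} [Group W]
    (cs : CoxeterSystem M W) {n : ℕ} (ρ : W →* HyperbolicSpace.Isom n)
    {X : Set (HyperbolicSpace n)} {V : Type*} (p : X → V) (v : V) : Set B :=
  {i | ∃ x : X, p x = v ∧ ρ (cs.simple i) (x : HyperbolicSpace n) = x}

end

/-!
The edge `e` cuts the vertices of `T` into two sides, and the convexity of the sides shows that the
canonical extension puts the same set of labels on each side as the labelling by fixed points
(`MetricTree.labelsOnSide_canonicalExtension`). So only the latter matters.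

If `m i j < ∞` for `i ≠ j`, then `s i` and `s j` generate a finite group, hence both are labels of
the vertex `p x`, where `x` is their chosen common fixed point
(`exists_mem_fixLabelling_of_ne_zero`), and both lie in `S⁺(e)` or both lie in `S⁻(e)`. As the
diagram is connected, every generator occurs on one side; the diagram is not a single vertex, since
then `X` would be empty and `T` would have no leaf, hence no edge. So each defining relation of `W`
holds in one of the groups `⟨S⁺(e)⟩`, `⟨S⁻(e)⟩`, and sending the generators to the amalgamated
product defines an inverse of the natural homomorphism to `W` (`isSpecialSplitting_of_cover`).

The splitting is trivial iff `⟨S^*(e)⟩` is one of `⟨S^±(e)⟩`. A fundamental generator in `⟨J⟩` has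
its index in `J` (`simple_mem_specialSubgroup_iff`), so this means that one of `S^±(e)` is contained
in the other, which is then all of `S`. That fact about special subgroups is proved with the
geometric representation, where `⟨J⟩` moves only the coordinates in `J`. Its defining relations
follow from the formula of `Module.reflection_mul_reflection_pow_apply` for the powers of a product
of two reflections.
-/

/-! ### The geometric representation -/

section GeometricRepresentation

open Polynomial.Chebyshev

/-- The product of two reflections whose pairings `f y`, `g x` both equal `-2 cos (π / m)` has
order dividing `m`. -/
theorem reflection_mul_reflection_pow_eq_one {E : Type*} [AddCommGroup E] [Module ℝ E]
    {x y : E} {f g : Module.Dual ℝ E} (hf : f x = 2) (hg : g y = 2) {m : ℕ} (hm : 2 ≤ m)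
    (hfy : f y = -2 * Real.cos (Real.pi / m)) (hgx : g x = -2 * Real.cos (Real.pi / m)) :
    (Module.reflection hf * Module.reflection hg) ^ m = 1 := by
  ext z
  rw [Module.reflection_mul_reflection_pow_apply hf hg m z _ rfl]
  rcases hm.eq_or_lt with rfl | hm
  · have hc : Real.cos (Real.pi / (2 : ℕ)) = 0 := by simp
    rw [hc, mul_zero] at hfy hgx
    simp only [hfy, hgx]
    norm_num
    module
  -- The Chebyshev values are `sin ((k + 1) φ) / sin φ` at the rotation angle `φ = 2π / m`.
  set φ : ℝ := 2 * (Real.pi / m) with hφ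
  have hm0 : (0 : ℝ) < m := by positivity
  have hmφ : m * φ = 2 * Real.pi := by rw [hφ]; field_simp
  have ht : f y * g x - 2 = 2 * Real.cos φ := by
    rw [hfy, hgx, hφ, Real.cos_two_mul]; ring
  have hsin : Real.sin φ ≠ 0 := by
    refine (Real.sin_pos_of_pos_of_lt_pi (by positivity) ?_).ne'
    have h3 : (3 : ℝ) ≤ m := by exact_mod_cast hm
    have : 3 * φ ≤ 2 * Real.pi := hmφ ▸ mul_le_mul_of_nonneg_right h3 (by positivity)
    linarith [Real.pi_pos]
  have hS (k : ℤ) : (S ℝ k).eval (f y * g x - 2) * Real.sin φ = Real.sin ((k + 1) * φ) := by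
    rw [ht, S_two_mul_real_cos]
  obtain ⟨k, rfl | rfl⟩ := Nat.even_or_odd' m
  · have e1 : (((2 * k : ℕ) : ℤ) - 2) / 2 = k - 1 := by omega
    have e2 : (((2 * k : ℕ) : ℤ) - 1) / 2 = k - 1 := by omega
    have h0 : (S ℝ (k - 1 : ℤ)).eval (f y * g x - 2) = 0 := by
      refine (mul_eq_zero_iff_right hsin).1 ?_
      rw [hS, show (((k - 1 : ℤ) : ℝ) + 1) * φ = Real.pi by push_cast at hmφ ⊢; linarith,
        Real.sin_pi]
    rw [e1, e2, h0]
    simp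
  · have e1 : (((2 * k + 1 : ℕ) : ℤ) - 2) / 2 = k - 1 := by omega
    have e2 : (((2 * k + 1 : ℕ) : ℤ) - 1) / 2 = k := by omega
    have e3 : (((2 * k + 1 : ℕ) : ℤ) - 3) / 2 = k - 1 := by omega
    have e4 : ((2 * k + 1 : ℕ) : ℤ) / 2 = k := by omega
    have h0 : (S ℝ (k : ℤ)).eval (f y * g x - 2) + (S ℝ (k - 1 : ℤ)).eval (f y * g x - 2) = 0 := by
      refine (mul_eq_zero_iff_right hsin).1 ?_
      rw [add_mul, hS, hS, show (((k : ℤ) : ℝ) + 1) * φ = 2 * Real.pi - k * φ by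
        push_cast at hmφ ⊢; linarith, Real.sin_two_pi_sub]
      push_cast
      ring_nf
    rw [e1, e2, e3, e4, h0]
    simp

variable {B : Type*}

/-- The linear form `v ↦ 2 ⟨α i, v⟩` on the real vector space with basis `(α j)`, where `⟨ , ⟩` is
the Tits form, `⟨α i, α j⟩ = -cos (π / m i j)`. For `m i j = ∞`, encoded as `M i j = 0`, the
convention `π / 0 = 0` gives the customary value `-1`. -/
noncomputable def simpleCoroot (M : CoxeterMatrix B) (i : B) : Module.Dual ℝ (B →₀ ℝ) :=
  Finsupp.linearCombination ℝ fun j => -2 * Real.cos (Real.pi / M i j)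

theorem simpleCoroot_single (M : CoxeterMatrix B) (i j : B) :
    simpleCoroot M i (Finsupp.single j 1) = -2 * Real.cos (Real.pi / M i j) := by
  simp [simpleCoroot]

theorem simpleCoroot_single_self (M : CoxeterMatrix B) (i : B) :
    simpleCoroot M i (Finsupp.single i 1) = 2 := by
  simp [simpleCoroot_single]

theorem isLiftable_reflection (M : CoxeterMatrix B) :
    M.IsLiftable fun i => Module.reflection (simpleCoroot_single_self M i) := by
  intro i j
  rcases eq_or_ne i j with rfl | hij
  · ext1 z
    simp [Module.involutive_reflection (simpleCoroot_single_self M i) z]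
  rcases eq_or_ne (M i j) 0 with h0 | h0
  · rw [h0, pow_zero]
  · have h1 := M.off_diagonal i j hij
    exact reflection_mul_reflection_pow_eq_one _ _ (by omega) (simpleCoroot_single M i j)
      (by rw [simpleCoroot_single, M.symmetric])

variable {M : CoxeterMatrix B} {W : Type*} [Group W]

/-- The geometric representation of a Coxeter group: a generator acts as the reflection in the
corresponding simple root. -/
noncomputable def geometricRepresentation (cs : CoxeterSystem M W) :
    W →* ((B →₀ ℝ) ≃ₗ[ℝ] (B →₀ ℝ)) :=
  cs.lift ⟨_, isLiftable_reflection M⟩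

theorem geometricRepresentation_simple (cs : CoxeterSystem M W) (i : B) (v : B →₀ ℝ) :
    geometricRepresentation cs (cs.simple i) v = v - simpleCoroot M i v • Finsupp.single i 1 := by
  rw [geometricRepresentation, cs.lift_apply_simple, Module.reflection_apply]

/-- The special subgroup `⟨J⟩` only moves the coordinates in `J`. -/
theorem geometricRepresentation_apply_of_notMem (cs : CoxeterSystem M W) {J : Set B} {i : B}
    (hi : i ∉ J) {w : W} (hw : w ∈ specialSubgroup cs J) (v : B →₀ ℝ) :
    geometricRepresentation cs w v i = v i := by
  induction hw using Subgroup.closure_induction generalizing v with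
  | mem w hw =>
    obtain ⟨j, hj, rfl⟩ := hw
    have hij : j ≠ i := fun h => hi (h ▸ hj)
    simp [geometricRepresentation_simple, Finsupp.single_eq_of_ne' hij]
  | one => simp
  | mul a b _ _ ha hb => rw [map_mul, LinearEquiv.mul_apply, ha, hb]
  | inv a _ ha =>
    rw [← ha (geometricRepresentation cs a⁻¹ v), ← LinearEquiv.mul_apply, ← map_mul]
    simp

/-- A special subgroup contains no further fundamental generators: `s i` changes the sign of the
`i`-th coordinate of the `i`-th simple root. -/
theorem simple_mem_specialSubgroup_iff (cs : CoxeterSystem M W) {J : Set B} {i : B} :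
    cs.simple i ∈ specialSubgroup cs J ↔ i ∈ J := by
  refine ⟨fun h => ?_, fun h => Subgroup.subset_closure ⟨i, h, rfl⟩⟩
  by_contra hi
  have := geometricRepresentation_apply_of_notMem cs hi h (Finsupp.single i 1)
  rw [geometricRepresentation_simple, simpleCoroot_single_self] at this
  norm_num at this

end GeometricRepresentation

/-! ### Special subgroups and splittings -/

section Splitting

variable {B : Type*} {M : CoxeterMatrix B} {W : Type*} [Group W]

theorem specialInclusion_bijective_iff (cs : CoxeterSystem M W) {J K : Set B} (h : J ⊆ K) :
    Function.Bijective (specialInclusion cs h) ↔ K ⊆ J := by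
  constructor
  · intro hb i hi
    obtain ⟨w, hw⟩ := hb.2 ⟨cs.simple i, (simple_mem_specialSubgroup_iff cs).2 hi⟩
    have hw' : (w : W) = cs.simple i := congrArg Subtype.val hw
    exact (simple_mem_specialSubgroup_iff cs).1 (hw' ▸ w.2)
  · rintro hKJ
    obtain rfl := h.antisymm hKJ
    exact ⟨Subgroup.inclusion_injective _, fun w => ⟨w, rfl⟩⟩

/-- Every element of `⟨i, j⟩` is a power of `s i * s j`, possibly followed by `s i`. -/
theorem finite_specialSubgroup_pair (cs : CoxeterSystem M W) {i j : B} (h : M i j ≠ 0) :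
    Finite (specialSubgroup cs {i, j}) := by
  set r := cs.simple i * cs.simple j with hr
  have hfin : (Subgroup.zpowers r : Set W).Finite :=
    finite_zpowers.2 (isOfFinOrder_iff_pow_eq_one.2
      ⟨M i j, Nat.pos_of_ne_zero h, cs.simple_mul_simple_pow i j⟩)
  have hinv : r⁻¹ = cs.simple j * cs.simple i := by simp [hr]
  have hconj (k : ℤ) : cs.simple i * r ^ k = r ^ (-k) * cs.simple i := by
    have : SemiconjBy (cs.simple i) r r⁻¹ := by
      simp [SemiconjBy, hr, mul_assoc]
    simpa using (this.zpow_right k).eq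
  have hj : cs.simple j = cs.simple i * r := by simp [hr]
  have key (k : ℤ) (u : W) (hu : u = 1 ∨ u = cs.simple i) :
      ∃ k' : ℤ, ∃ u', (u' = 1 ∨ u' = cs.simple i) ∧ cs.simple i * (r ^ k * u) = r ^ k' * u' := by
    rcases hu with rfl | rfl
    · exact ⟨-k, _, Or.inr rfl, by rw [mul_one, hconj]⟩
    · exact ⟨-k, _, Or.inl rfl, by rw [← mul_assoc, hconj, mul_assoc]; simp⟩
  refine Set.Finite.subset (hfin.mul (Set.toFinite {1, cs.simple i})) fun w hw => ?_
  suffices H : ∃ k : ℤ, ∃ u, (u = 1 ∨ u = cs.simple i) ∧ w = r ^ k * u by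
    obtain ⟨k, u, hu, rfl⟩ := H
    exact Set.mul_mem_mul (Subgroup.zpow_mem_zpowers r k) hu
  have hstep (x : W) (hx : x ∈ cs.simple '' {i, j}) (y : W)
      (hy : ∃ k : ℤ, ∃ u, (u = 1 ∨ u = cs.simple i) ∧ y = r ^ k * u) :
      ∃ k : ℤ, ∃ u, (u = 1 ∨ u = cs.simple i) ∧ x * y = r ^ k * u := by
    obtain ⟨k, u, hu, rfl⟩ := hy
    obtain ⟨l, rfl | rfl, rfl⟩ := hx
    · exact key k u hu
    · have := key (k + 1) u hu
      rwa [add_comm, zpow_one_add, mul_assoc r, ← mul_assoc, ← hj] at this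
  refine Subgroup.closure_induction_left ⟨0, 1, by simp⟩ (fun x hx y _ hy => hstep x hx y hy)
    (fun x hx y _ hy => ?_) hw
  have hx' : x⁻¹ = x := by
    obtain ⟨l, -, rfl⟩ := hx
    exact cs.inv_simple l
  rw [hx']
  exact hstep x hx y hy

/-- The homomorphism from a factor to the amalgamated product. -/
def SpecialAmalgam.of (cs : CoxeterSystem M W) {J : Bool → Set B} {C : Set B}
    (h : ∀ b, C ⊆ J b) (b : Bool) : specialSubgroup cs (J b) →* SpecialAmalgam cs h :=
  Monoid.PushoutI.of (φ := fun b : Bool => specialInclusion cs (h b)) b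

theorem SpecialAmalgam.toGroup_of (cs : CoxeterSystem M W) {J : Bool → Set B} {C : Set B}
    (h : ∀ b, C ⊆ J b) (b : Bool) (w : specialSubgroup cs (J b)) :
    SpecialAmalgam.toGroup cs h (SpecialAmalgam.of cs h b w) = w :=
  Monoid.PushoutI.lift_of (φ := fun b : Bool => specialInclusion cs (h b))
    (fun b => (specialSubgroup cs (J b)).subtype) (specialSubgroup cs C).subtype (fun _ => rfl) w

/-- The image in the amalgamated product of the fundamental generator `i` in the factor `b`. -/
def SpecialAmalgam.simple (cs : CoxeterSystem M W) {J : Bool → Set B} {C : Set B}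
    (h : ∀ b, C ⊆ J b) {b : Bool} {i : B} (hi : i ∈ J b) : SpecialAmalgam cs h :=
  SpecialAmalgam.of cs h b ⟨cs.simple i, (simple_mem_specialSubgroup_iff cs).2 hi⟩

theorem SpecialAmalgam.simple_eq_of_mem (cs : CoxeterSystem M W) {J : Bool → Set B} {C : Set B}
    (h : ∀ b, C ⊆ J b) {b b' : Bool} {i : B} (hi : i ∈ C) :
    SpecialAmalgam.simple cs h (h b hi) = SpecialAmalgam.simple cs h (h b' hi) := by
  have key (b : Bool) := Monoid.PushoutI.of_apply_eq_base
    (fun b : Bool => specialInclusion cs (h b)) b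
    ⟨cs.simple i, (simple_mem_specialSubgroup_iff cs).2 hi⟩
  exact (key b).trans (key b').symm

theorem SpecialAmalgam.simple_mul_simple_pow (cs : CoxeterSystem M W) {J : Bool → Set B}
    {C : Set B} (h : ∀ b, C ⊆ J b) {b : Bool} {i j : B} (hi : i ∈ J b) (hj : j ∈ J b) :
    (SpecialAmalgam.simple cs h hi * SpecialAmalgam.simple cs h hj) ^ M i j = 1 := by
  rw [simple, simple, ← map_mul, ← map_pow, ← map_one (SpecialAmalgam.of cs h b)]
  exact congrArg _ (Subtype.ext (cs.simple_mul_simple_pow i j))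

/-- Homomorphisms out of the amalgamated product are determined by their values on the fundamental
generators of the factors. -/
theorem SpecialAmalgam.hom_ext (cs : CoxeterSystem M W) {J : Bool → Set B} {C : Set B}
    (h : ∀ b, C ⊆ J b) {G : Type*} [Group G] {f g : SpecialAmalgam cs h →* G}
    (hfg : ∀ (b : Bool) (i : B) (hi : i ∈ J b),
      f (SpecialAmalgam.simple cs h hi) = g (SpecialAmalgam.simple cs h hi)) : f = g := by
  refine Monoid.PushoutI.hom_ext_nonempty fun b => ?_
  refine MonoidHom.eq_of_eqOn_dense (Subgroup.closure_closure_coe_preimage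
    (k := cs.simple '' J b)) ?_
  rintro ⟨-, hw⟩ ⟨i, hi, rfl⟩
  exact hfg b i hi

/-- If `J true ∪ J false` is the set of all generators and every finite entry of the Coxeter matrix
is between two generators of one of the two sets, then all the relations of `W` hold in the
amalgamated product, which gives the inverse of the homomorphism to `W`. -/
theorem isSpecialSplitting_of_cover (cs : CoxeterSystem M W) (J : Bool → Set B)
    (hcover : ∀ i, ∃ b, i ∈ J b) (hpair : ∀ i j, M i j ≠ 0 → ∃ b, i ∈ J b ∧ j ∈ J b) :
    IsSpecialSplitting cs J (J true ∩ J false) := by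
  have hC : ∀ b, J true ∩ J false ⊆ J b := by
    rintro (_ | _)
    exacts [Set.inter_subset_right, Set.inter_subset_left]
  refine ⟨hC, ?_⟩
  choose σ hσ using hcover
  let F (i : B) : SpecialAmalgam cs hC := SpecialAmalgam.simple cs hC (hσ i)
  have hF {b : Bool} {i : B} (hi : i ∈ J b) : F i = SpecialAmalgam.simple cs hC hi := by
    rcases eq_or_ne (σ i) b with rfl | hb
    · rfl
    · have hi' : i ∈ J true ∩ J false := by
        have := hσ i
        cases b <;> cases h : σ i <;> simp_all
      exact SpecialAmalgam.simple_eq_of_mem cs hC hi'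
  have hlift : M.IsLiftable F := by
    intro i j
    rcases eq_or_ne (M i j) 0 with h0 | h0
    · rw [h0, pow_zero]
    · obtain ⟨b, hi, hj⟩ := hpair i j h0
      rw [hF hi, hF hj, SpecialAmalgam.simple_mul_simple_pow]
  let ψ : W →* SpecialAmalgam cs hC := cs.lift ⟨F, hlift⟩
  have hψ (i : B) : ψ (cs.simple i) = F i := cs.lift_apply_simple hlift i
  have hto {b : Bool} {i : B} (hi : i ∈ J b) :
      SpecialAmalgam.toGroup cs hC (SpecialAmalgam.simple cs hC hi) = cs.simple i :=
    SpecialAmalgam.toGroup_of cs hC b _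
  have hleft : ψ.comp (SpecialAmalgam.toGroup cs hC) = MonoidHom.id _ := by
    refine SpecialAmalgam.hom_ext cs hC fun b i hi => ?_
    rw [MonoidHom.comp_apply, hto, hψ, hF hi, MonoidHom.id_apply]
  have hright : (SpecialAmalgam.toGroup cs hC).comp ψ = MonoidHom.id _ := by
    refine cs.ext_simple fun i => ?_
    rw [MonoidHom.comp_apply, hψ, hto, MonoidHom.id_apply]
  exact Function.bijective_iff_has_inverse.2
    ⟨ψ, DFunLike.congr_fun hleft, DFunLike.congr_fun hright⟩

end Splitting

/-! ### Labels on the two sides of an edge of a tree -/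

namespace MetricTree

variable {V : Type*} [Finite V] (T : MetricTree V)

theorem exists_mem_side (e : T.graph.Dart) (v : V) : ∃ b, v ∈ T.side e b := by
  suffices H : ∀ u, T.graph.Walk u v → (∃ b, u ∈ T.side e b) → ∃ b, v ∈ T.side e b by
    obtain ⟨w⟩ := T.isTree.connected.preconnected e.fst v
    exact H _ w ⟨false, SimpleGraph.Reachable.refl _⟩
  intro u w
  induction w with
  | nil => exact id
  | @cons u u' _ huu' _ ih =>
    rintro ⟨b, hb⟩
    apply ih
    by_cases he : s(u, u') = e.edge
    · rcases SimpleGraph.dart_edge_eq_mk'_iff'.1 he.symm with ⟨h1, h2⟩ | ⟨h1, h2⟩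
      · exact ⟨true, h2 ▸ SimpleGraph.Reachable.refl _⟩
      · exact ⟨false, h1 ▸ SimpleGraph.Reachable.refl _⟩
    · refine ⟨b, SimpleGraph.Reachable.trans hb (SimpleGraph.Adj.reachable ?_)⟩
      rw [SimpleGraph.deleteEdges_adj]
      exact ⟨huu', he⟩

/-- Each side of an edge is convex: a path of `T - e` is the path of `T` between its ends. -/
theorem reachable_of_mem_segment {e : T.graph.Dart} {b : Bool} {x y v : V}
    (hx : x ∈ T.side e b) (hy : y ∈ T.side e b) (hv : v ∈ T.segment x y) :
    (T.graph.deleteEdges {e.edge}).Reachable x v := by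
  classical
  obtain ⟨w, hw⟩ := ((SimpleGraph.Reachable.symm hx).trans hy).exists_isPath
  have hle := T.graph.deleteEdges_le {e.edge}
  have hpath : w.mapLe hle = T.path x y :=
    (T.isTree.existsUnique_path x y).unique (hw.mapLe hle)
      (T.isTree.existsUnique_path x y).choose_spec.1
  have hv' : v ∈ w.support := by
    rw [segment, Set.mem_ofPred_eq, ← hpath] at hv
    simpa using hv
  exact ⟨w.takeUntil v hv'⟩

/-- The canonical extension puts no new label on a side of an edge: a path which meets the side
has an end in it. -/
theorem labelsOnSide_canonicalExtension {B : Type*} (L : V → Set B) (e : T.graph.Dart)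
    (b : Bool) : T.labelsOnSide (T.canonicalExtension L) e b = T.labelsOnSide L e b := by
  ext s
  simp only [labelsOnSide, Set.mem_iUnion, exists_prop]
  constructor
  · rintro ⟨v, hv, x, y, hxy, hsx, hsy⟩
    by_contra! hno
    have hother {z : V} (hz : s ∈ L z) : z ∈ T.side e (!b) := by
      obtain ⟨b', hb'⟩ := T.exists_mem_side e z
      have hne : b' ≠ b := by
        rintro rfl
        exact hno z hb' hz
      rwa [Bool.eq_not_of_ne hne] at hb'
    have hxv := T.reachable_of_mem_segment (hother hsx) (hother hsy) hxy
    exact hno x (SimpleGraph.Reachable.trans hv hxv.symm) hsx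
  · rintro ⟨v, hv, hs⟩
    exact ⟨v, hv, v, v, (T.path v v).start_mem_support, hs, hs⟩

theorem leaves_nonempty (e : T.graph.Dart) : T.leaves.Nonempty := by
  classical
  have := Fintype.ofFinite V
  have : Nontrivial V := ⟨e.fst, e.snd, e.adj.ne⟩
  obtain ⟨v, hv⟩ := T.isTree.exists_vert_degree_one_of_nontrivial
  refine ⟨v, ?_⟩
  rw [leaves, Set.mem_ofPred_eq, ← hv, ← SimpleGraph.card_neighborSet_eq_degree,
    ← Nat.card_eq_fintype_card]
  rfl

end MetricTree

/-! ### Labels given by fixed points -/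

section FixLabelling

variable {B : Type*} {M : CoxeterMatrix B} {W : Type*} [Group W] {cs : CoxeterSystem M W}
  {n : ℕ} {ρ : W →* HyperbolicSpace.Isom n} {X : Set (HyperbolicSpace n)} {V : Type*}

/-- If `m i j < ∞`, then `i` and `j` are labels of the vertex of their chosen fixed point. -/
theorem exists_mem_fixLabelling_of_ne_zero (hX : IsRepresentativeSet cs ρ X) (p : X → V) {i j : B}
    (hij : i ≠ j) (h : M i j ≠ 0) : ∃ v, i ∈ fixLabelling cs ρ p v ∧ j ∈ fixLabelling cs ρ p v := by
  classical
  obtain ⟨r, hr, rfl⟩ := hX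
  let P : finiteDihedralPairs cs :=
    ⟨{i, j}, Finset.card_pair hij, by simpa using finite_specialSubgroup_pair cs h⟩
  have hP := hr P
  exact ⟨p ⟨r P, P, rfl⟩, ⟨_, rfl, hP i (by simp [P])⟩, ⟨_, rfl, hP j (by simp [P])⟩⟩

theorem nontrivial_of_isRepresentativeSet (hX : IsRepresentativeSet cs ρ X) (hne : X.Nonempty) :
    Nontrivial B := by
  classical
  obtain ⟨r, -, rfl⟩ := hX
  obtain ⟨-, ⟨P, hP, -⟩, -⟩ := hne
  obtain ⟨i, j, hij, -⟩ := Finset.card_eq_two.1 hP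
  exact ⟨i, j, hij⟩

/-- In a connected diagram with at least two vertices every generator lies on an edge. -/
theorem exists_mem_fixLabelling [Nontrivial B] (hconn : (coxeterDiagram M).Connected)
    (hX : IsRepresentativeSet cs ρ X) (p : X → V) (i : B) : ∃ v, i ∈ fixLabelling cs ρ p v := by
  obtain ⟨j, hij, h⟩ := hconn.preconnected.exists_adj_of_nontrivial i
  obtain ⟨v, hv, -⟩ := exists_mem_fixLabelling_of_ne_zero hX p hij h
  exact ⟨v, hv⟩

end FixLabelling

theorem mainTheorem7 {B : Type*} [Finite B] {M : CoxeterMatrix B} {W : Type*} [Group W]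
    (cs : CoxeterSystem M W) (hconn : (coxeterDiagram M).Connected)
    (n : ℕ) (ρ : W →* HyperbolicSpace.Isom n) (hρ : IsDiscreteFaithful ρ)
    (X : Set (HyperbolicSpace n)) (hX : IsRepresentativeSet cs ρ X)
    {V : Type*} [Finite V] (T : MetricTree V) (p : X → V) (c : ℝ)
    (hT : T.IsGromovApproximating X p c)
    (e : T.graph.Dart)
    (L : V → Set B)
    (hL : L = fixLabelling cs ρ p ∨ L = T.canonicalExtension (fixLabelling cs ρ p)) :
    let S : Bool → Set B := T.labelsOnSide L e
    let S' : Set B := S true ∩ S false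
    IsSpecialSplitting cs S S' ∧
      (IsTrivialSplitting cs S S' ↔
        T.IsUseless (T.canonicalExtension (fixLabelling cs ρ p)) e) ∧
      (T.IsUseless (T.canonicalExtension (fixLabelling cs ρ p)) e ↔
        S true = Set.univ ∨ S false = Set.univ) := by
  intro S S'
  have hS : S = T.labelsOnSide (fixLabelling cs ρ p) e := by
    rcases hL with rfl | rfl
    · rfl
    · exact funext fun b => T.labelsOnSide_canonicalExtension _ e b
  have huseless : T.IsUseless (T.canonicalExtension (fixLabelling cs ρ p)) e ↔
      S true = Set.univ ∨ S false = Set.univ := by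
    simp only [MetricTree.IsUseless, T.labelsOnSide_canonicalExtension, ← hS, Set.univ_subset_iff,
      Bool.exists_bool, or_comm]
  -- A tree with an edge has a leaf, which is the image of a point of `X`.
  obtain ⟨v, hv⟩ := T.leaves_nonempty e
  obtain ⟨x, -⟩ := hT.leaves_subset hv
  have := nontrivial_of_isRepresentativeSet hX ⟨x, x.2⟩
  have hmem {v : V} {b : Bool} (hv : v ∈ T.side e b) {i : B} (hi : i ∈ fixLabelling cs ρ p v) :
      i ∈ S b := by
    rw [hS]
    exact Set.mem_biUnion hv hi
  have hcover (i : B) : ∃ b, i ∈ S b := by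
    obtain ⟨v, hi⟩ := exists_mem_fixLabelling hconn hX p i
    obtain ⟨b, hb⟩ := T.exists_mem_side e v
    exact ⟨b, hmem hb hi⟩
  have hpair (i j : B) (h : M i j ≠ 0) : ∃ b, i ∈ S b ∧ j ∈ S b := by
    rcases eq_or_ne i j with rfl | hij
    · simpa using hcover i
    · obtain ⟨v, hi, hj⟩ := exists_mem_fixLabelling_of_ne_zero hX p hij h
      obtain ⟨b, hb⟩ := T.exists_mem_side e v
      exact ⟨b, hmem hb hi, hmem hb hj⟩
  refine ⟨isSpecialSplitting_of_cover cs S hcover hpair, ?_, huseless⟩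
  have hunion : S true ∪ S false = Set.univ :=
    Set.eq_univ_of_forall fun i => by simpa [or_comm] using hcover i
  -- Since the two sets cover `B`, one of them is contained in the other iff the other is all of `B`.
  have htriv : IsTrivialSplitting cs S S' ↔ ∃ b, S b ⊆ S' := by
    constructor
    · rintro ⟨b, h, hb⟩
      exact ⟨b, (specialInclusion_bijective_iff cs h).1 hb⟩
    · rintro ⟨b, hb⟩
      have h : S' ⊆ S b := by
        cases b
        exacts [Set.inter_subset_right, Set.inter_subset_left]
      exact ⟨b, h, (specialInclusion_bijective_iff cs h).2 hb⟩
  rw [htriv, huseless, Bool.exists_bool]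
  refine or_congr ?_ ?_
  · rw [Set.subset_inter_iff, and_iff_left subset_rfl, ← hunion, eq_comm, Set.union_eq_left]
  · rw [Set.subset_inter_iff, and_iff_right subset_rfl, ← hunion, eq_comm, Set.union_eq_right]
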